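/- Let $n,d\ge 1$ be integers. The $d$-dimensional Lights Out automaton of side length $n$ has the cells $\{1,\dots,n\}^d$ with states in $\mathbb{Z}/2$; at each step the new state of a cell is the sum modulo $2$ of the old states of its nearest neighbours (the cells that differ from it by one in a single coordinate and agree with it in the others). For a square matrix $X$ over $\mathbb{Z}/2$, the cycle length $CL(X)$ is the least $i>0$ such that $X^{k}=X^{k+i}$ for some $k\ge 0$. Let $A_n$ be the $n\times n$ matrix over $\mathbb{Z}/2$ with ones exactly on the two diagonals adjacent to the main diagonal, let $M\oplus N=M\otimes I+I\otimes N$ denote the Kronecker sum, and for odd $b$ let $\mathrm{sord}_2(b)$ be the least $j>0$ with $2^j\equiv\pm1 \pmod b$. Then: 1. The transition matrix of the automaton is the $d$-fold Kronecker sum $A_n\oplus\cdots\oplus A_n$. Let $CL(n,d)$ be its cycle length. 2. For every $n\ge1$, $CL(n,d)$ is bounded by a constant that does not depend on $d$. 3. If $n$ is even, then $CL(n,d)$ divides $2\,(2^{\mathrm{sord}_2(n+1)}-1)$ for every $d\ge1$. 4. If $n\ge 6$ is even, then there is a $D$ (depending on $n$) such that $CL(n,d)=2\,(2^{\mathrm{sord}_2(n+1)}-1)$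 for all $d\ge D$. 5. For $d\ge 1$, $CL(2,d)$ equals $2$ if $d$ is odd and $1$ if $d$ is even, and $CL(4,d)$ equals $6$ if $d$ is odd and $2$ if $d$ is even. -/

import Mathlib

open scoped Kronecker

/-- The transition matrix `A_n` over `GF(2)` of the one-dimensional automaton on `n` cells:
ones exactly on the two diagonals adjacent to the main diagonal. -/
def lineMatrix (n : ℕ) : Matrix (Fin n) (Fin n) (ZMod 2) :=
  Matrix.of fun x y => if x.val + 1 = y.val ∨ y.val + 1 = x.val then 1 else 0

/-- The Kronecker sum `M ⊕ N = M ⊗ I + I ⊗ N`. -/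
def kroneckerSum {R m n : Type*} [CommRing R] [DecidableEq m] [DecidableEq n]
    (M : Matrix m m R) (N : Matrix n n R) : Matrix (m × n) (m × n) R :=
  M ⊗ₖ (1 : Matrix n n R) + (1 : Matrix m m R) ⊗ₖ N

/-- The `d`-fold Kronecker sum `M ⊕ (M ⊕ (⋯ ⊕ M))`. Its index set is the set of `d`-tuples of
indices of `M`, a pair `(a, x)` being identified with the tuple `(a, x 0, x 1, …)`. The `0`-fold
sum is the `1 × 1` zero matrix, which is neutral for `⊕`. -/
def iteratedKroneckerSum {R m : Type*} [CommRing R] [DecidableEq m] (M : Matrix m m R) :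
    (d : ℕ) → Matrix (Fin d → m) (Fin d → m) R
  | 0 => 0
  | d + 1 =>
    Matrix.reindex (Fin.consEquiv fun _ : Fin (d + 1) => m) (Fin.consEquiv fun _ : Fin (d + 1) => m)
      (kroneckerSum M (iteratedKroneckerSum M d))

/-- Two cells of the `n × ⋯ × n` lattice (`d` factors) are nearest neighbours if they differ by one
in a single coordinate and agree in all the others. -/
def IsNeighbor {d n : ℕ} (x y : Fin d → Fin n) : Prop :=
  ∃ i, ((x i).val + 1 = (y i).val ∨ (y i).val + 1 = (x i).val) ∧ ∀ j, j ≠ i → x j = y j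

open scoped Classical in
/-- One step of the `d`-dimensional Lights Out automaton: the new state of a cell is the sum
modulo 2 of the old states of its nearest neighbours. -/
noncomputable def lightsOutStep {d n : ℕ} (v : (Fin d → Fin n) → ZMod 2) :
    (Fin d → Fin n) → ZMod 2 :=
  fun x => ∑ y with IsNeighbor x y, v y

/-- The cycle length of a matrix `X`: the least `i > 0` such that `X ^ k = X ^ (k + i)`
for some `k`. -/
noncomputable def cycleLength {ι R : Type*} [Fintype ι] [DecidableEq ι] [CommRing R]
    (X : Matrix ι ι R) : ℕ :=
  sInf {i | 0 < i ∧ ∃ k, X ^ k = X ^ (k + i)}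

/-- The cycle length of the `d`-dimensional Lights Out automaton of side length `n`: that of
the `d`-fold Kronecker sum of `A_n`. -/
noncomputable def lightsOutCycleLength (n d : ℕ) : ℕ :=
  cycleLength (iteratedKroneckerSum (lineMatrix n) d)

/-- `sord₂(b)` (for odd `b`): the least `j > 0` such that `2 ^ j ≡ ±1` modulo `b`. -/
noncomputable def sordTwo (b : ℕ) : ℕ :=
  sInf {j | 0 < j ∧ ((2 : ZMod b) ^ j = 1 ∨ (2 : ZMod b) ^ j = -1)}

/-! Write X for the `d`-fold Kronecker sum of A = `lineMatrix n`. In characteristic 2 squaring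
commutes with Kronecker sums, so X^(2^j) is the `d`-fold sum of A^(2^j), and every relation A^(2^a)
= A^(2^c) passes to X for all `d` at once. Pigeonhole on the powers A^(2^j) bounds the cycle length.

For even n, reflecting a state at the multiples of n + 1 turns A into T + T⁻¹, with T the shift of
sequences of period 2(n + 1). Hence A^(2^j) acts as T^(2^j) + T^(-2^j). If 2^s ≡ ±1 mod n + 1 then
2^(s+1) ≡ ±2 mod 2(n + 1), so A^(2^(s+1)) = A^2: this is the divisibility (`lineMatrix_pow_two_pow`,
`lightsOut_pow_eq`).

For the converse, sums x of `d` numbers z + z⁻¹, with z a nontrivial (n+1)-th root of unity, are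
eigenvalues of X. A cycle length i satisfies x^i = 1 for each x ≠ 0, and i is even because X only
joins cells of opposite parity. For large `d` these sums fill at least half of the field generated
by ζ + ζ⁻¹, ζ a primitive root, which has at least 2^s elements, s = `sordTwo (n + 1)`. So gcd(i,
2^s - 1) is at least 2^(s-1) - 1, and once s ≥ 3 this forces it to be 2^s - 1. Sides 2 and 4 have s
< 3 and are treated by hand. -/

/-! ### Cycle length as a period -/

theorem cycleLength_dvd {ι R : Type*} [Fintype ι] [DecidableEq ι] [CommRing R]
    {X : Matrix ι ι R} {i k : ℕ} (h : X ^ k = X ^ (k + i)) : cycleLength X ∣ i := by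
  rcases Nat.eq_zero_or_pos i with rfl | hi
  · exact dvd_zero _
  have hne : {i | 0 < i ∧ ∃ k, X ^ k = X ^ (k + i)}.Nonempty := ⟨i, hi, k, h⟩
  obtain ⟨hc, l, hl⟩ := Nat.sInf_mem hne
  change 0 < cycleLength X at hc
  change X ^ l = X ^ (l + cycleLength X) at hl
  have hmul : ∀ q m, X ^ (l + m) = X ^ (l + m + cycleLength X * q) := by
    intro q m
    induction q with
    | zero => simp
    | succ q ih =>
      rw [ih, show l + m + cycleLength X * (q + 1) = l + cycleLength X + (m + cycleLength X * q)
        by ring, pow_add X (l + cycleLength X), ← hl, ← pow_add]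
      congr 1
      ring
  by_contra hd
  have hpos : 0 < i % cycleLength X :=
    Nat.pos_of_ne_zero fun h0 => hd (Nat.dvd_of_mod_eq_zero h0)
  -- Both relations are available from exponent `l + k` on, so the remainder would be a smaller
  -- period.
  refine absurd (Nat.mod_lt i hc) (not_lt.2 (Nat.sInf_le ⟨hpos, l + k, ?_⟩))
  rw [show l + k + i % cycleLength X = l + (k + i % cycleLength X) by ring,
    hmul (i / cycleLength X) (k + i % cycleLength X), add_assoc, add_assoc, Nat.mod_add_div,
    pow_add X l (k + i), ← h, ← pow_add]

theorem cycleLength_mem {ι R : Type*} [Fintype ι] [DecidableEq ι] [CommRing R]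
    {X : Matrix ι ι R} {i k : ℕ} (hi : 0 < i) (h : X ^ k = X ^ (k + i)) :
    0 < cycleLength X ∧ ∃ k, X ^ k = X ^ (k + cycleLength X) :=
  Nat.sInf_mem (s := {i | 0 < i ∧ ∃ k, X ^ k = X ^ (k + i)}) ⟨i, hi, k, h⟩

/-! ### Iterated Kronecker sums in characteristic 2 -/

section IteratedKroneckerSum

variable {R m : Type*} [CommRing R] [DecidableEq m]

theorem iteratedKroneckerSum_succ_apply (M : Matrix m m R) (d : ℕ) (x y : Fin (d + 1) → m) :
    iteratedKroneckerSum M (d + 1) x y =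
      (if Fin.tail x = Fin.tail y then M (x 0) (y 0) else 0) +
      if x 0 = y 0 then iteratedKroneckerSum M d (Fin.tail x) (Fin.tail y) else 0 := by
  simp [iteratedKroneckerSum, kroneckerSum, Matrix.one_apply, Fin.consEquiv]

theorem iteratedKroneckerSum_succ_mulVec [Fintype m] (M : Matrix m m R) (d : ℕ) (w : (Fin (d + 1) → m) → R)
    (a : m) (x : Fin d → m) :
    (iteratedKroneckerSum M (d + 1)).mulVec w (Fin.cons a x) =
      M.mulVec (fun b => w (Fin.cons b x)) a +
      (iteratedKroneckerSum M d).mulVec (fun y => w (Fin.cons a y)) x := by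
  simp only [Matrix.mulVec, dotProduct]
  rw [← (Fin.consEquiv fun _ : Fin (d + 1) => m).sum_comp, Fintype.sum_prod_type]
  simp [iteratedKroneckerSum_succ_apply, Fin.consEquiv, add_mul, ite_mul,
    Finset.sum_add_distrib]

theorem iteratedKroneckerSum_mulVec_prod [Fintype m] (M : Matrix m m R) (d : ℕ) (u : Fin d → m → R)
    (θ : Fin d → R) (h : ∀ j, M.mulVec (u j) = θ j • u j) :
    (iteratedKroneckerSum M d).mulVec (fun x => ∏ j, u j (x j)) =
      (∑ j, θ j) • fun x => ∏ j, u j (x j) := by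
  induction d with
  | zero => simp [iteratedKroneckerSum]
  | succ d ih =>
    funext x
    obtain ⟨a, x, rfl⟩ : ∃ a y, x = Fin.cons a y := ⟨x 0, Fin.tail x, (Fin.cons_self_tail x).symm⟩
    rw [iteratedKroneckerSum_succ_mulVec]
    have h0 := congrFun (h 0) a
    have h1 := congrFun (ih (fun j => u j.succ) (fun j => θ j.succ) fun j => h j.succ) x
    simp only [Pi.smul_apply, smul_eq_mul, Matrix.mulVec, dotProduct] at h0 h1 ⊢
    simp only [Fin.prod_univ_succ, Fin.cons_zero, Fin.cons_succ, Fin.sum_univ_succ]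
    simp only [← mul_assoc, ← Finset.sum_mul, h0]
    simp only [mul_comm _ (u 0 a), mul_assoc, ← Finset.mul_sum, h1]
    ring

theorem iteratedKroneckerSum_add (M N : Matrix m m R) (d : ℕ) :
    iteratedKroneckerSum (M + N) d = iteratedKroneckerSum M d + iteratedKroneckerSum N d := by
  induction d with
  | zero => simp [iteratedKroneckerSum]
  | succ d ih =>
    ext x y
    simp only [iteratedKroneckerSum_succ_apply, Matrix.add_apply, ih]
    split_ifs <;> ring

theorem iteratedKroneckerSum_one (d : ℕ) :
    iteratedKroneckerSum (1 : Matrix m m R) d = (d : Matrix (Fin d → m) (Fin d → m) R) := by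
  induction d with
  | zero => simp [iteratedKroneckerSum]
  | succ d ih =>
    ext x y
    obtain ⟨a, x, rfl⟩ : ∃ a y, x = Fin.cons a y := ⟨x 0, Fin.tail x, (Fin.cons_self_tail x).symm⟩
    obtain ⟨b, y, rfl⟩ : ∃ a z, y = Fin.cons a z := ⟨y 0, Fin.tail y, (Fin.cons_self_tail y).symm⟩
    simp only [iteratedKroneckerSum_succ_apply, ih, Matrix.one_apply, ← Matrix.diagonal_natCast,
      Matrix.diagonal_apply, Fin.cons_zero, Fin.tail_cons, Fin.cons_inj]
    by_cases h1 : a = b <;> by_cases h2 : x = y <;> simp [h1, h2, add_comm]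

theorem iteratedKroneckerSum_map {S : Type*} [CommRing S] (f : R →+* S) (M : Matrix m m R)
    (d : ℕ) : (iteratedKroneckerSum M d).map f = iteratedKroneckerSum (M.map f) d := by
  induction d with
  | zero => simp [iteratedKroneckerSum]
  | succ d ih =>
    ext x y
    have := congrFun (congrFun ih (Fin.tail x)) (Fin.tail y)
    simp only [Matrix.map_apply] at this
    simp only [Matrix.map_apply, iteratedKroneckerSum_succ_apply, map_add, ← this]
    split_ifs <;> simp

/-- The summands M ⊗ I and I ⊗ N commute, so the cross term M ⊗ N occurs twice and vanishes. -/
theorem iteratedKroneckerSum_sq [Fintype m] [CharP R 2] (M : Matrix m m R) (d : ℕ) :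
    iteratedKroneckerSum M d ^ 2 = iteratedKroneckerSum (M ^ 2) d := by
  induction d with
  | zero => simp [iteratedKroneckerSum]
  | succ d ih =>
    have key : kroneckerSum M (iteratedKroneckerSum M d) ^ 2 =
        kroneckerSum (M ^ 2) (iteratedKroneckerSum (M ^ 2) d) := by
      rw [← ih]
      simp only [kroneckerSum, pow_two, add_mul, mul_add, ← Matrix.mul_kronecker_mul, one_mul,
        mul_one]
      ext x y
      simp only [Matrix.add_apply]
      linear_combination CharTwo.add_self_eq_zero ((M ⊗ₖ iteratedKroneckerSum M d) x y)
    rw [iteratedKroneckerSum, iteratedKroneckerSum, ← key]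
    simp only [pow_two, Matrix.reindex_apply, Matrix.submatrix_mul_equiv]

theorem iteratedKroneckerSum_pow_two_pow [Fintype m] [CharP R 2] (M : Matrix m m R) (d j : ℕ) :
    iteratedKroneckerSum M d ^ 2 ^ j = iteratedKroneckerSum (M ^ 2 ^ j) d := by
  induction j with
  | zero => simp
  | succ j ih => rw [pow_succ, pow_mul, ih, iteratedKroneckerSum_sq, ← pow_mul]

end IteratedKroneckerSum

/-! ### Parity grading -/

theorem Matrix.pow_apply_eq_zero_of_grading {ι R : Type*} [Fintype ι] [DecidableEq ι] [CommRing R]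
    {X : Matrix ι ι R} (p : ι → ZMod 2) (hX : ∀ x y, X x y ≠ 0 → p y = p x + 1) (k : ℕ) (x y : ι)
    (h : (X ^ k) x y ≠ 0) : p y = p x + k := by
  induction k generalizing y with
  | zero =>
    by_cases hxy : x = y
    · simp [hxy]
    · simp [hxy] at h
  | succ k ih =>
    rw [pow_succ, Matrix.mul_apply] at h
    obtain ⟨z, -, hz⟩ := Finset.exists_ne_zero_of_sum_ne_zero h
    rw [hX z y (right_ne_zero_of_mul hz), ih z (left_ne_zero_of_mul hz)]
    push_cast
    ring

/-- Powers with exponents of opposite parity have disjoint supports. An odd period is therefore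
possible only for a nilpotent matrix. -/
theorem Matrix.pow_eq_zero_of_grading {ι R : Type*} [Fintype ι] [DecidableEq ι] [CommRing R]
    {X : Matrix ι ι R} (p : ι → ZMod 2) (hX : ∀ x y, X x y ≠ 0 → p y = p x + 1) {k i : ℕ}
    (h : X ^ k = X ^ (k + i)) (hi : ¬ 2 ∣ i) : X ^ k = 0 := by
  ext x y
  by_contra hne
  have h1 := pow_apply_eq_zero_of_grading p hX k x y hne
  have h2 := pow_apply_eq_zero_of_grading p hX (k + i) x y (h ▸ hne)
  apply hi
  rw [← ZMod.natCast_eq_zero_iff]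
  push_cast at h2
  linear_combination h1 - h2

theorem lineMatrix_apply {n : ℕ} (x y : Fin n) :
    lineMatrix n x y = if x.val + 1 = y.val ∨ y.val + 1 = x.val then 1 else 0 := rfl

theorem iteratedKroneckerSum_lineMatrix_grading (n d : ℕ) (x y : Fin d → Fin n)
    (h : iteratedKroneckerSum (lineMatrix n) d x y ≠ 0) :
    (∑ j, ((y j).val : ZMod 2)) = (∑ j, ((x j).val : ZMod 2)) + 1 := by
  induction d with
  | zero => simp [iteratedKroneckerSum] at h
  | succ d ih =>
    rw [iteratedKroneckerSum_succ_apply] at h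
    rw [Fin.sum_univ_succ, Fin.sum_univ_succ]
    by_cases h1 : Fin.tail x = Fin.tail y
    · have h2 : ∀ j : Fin d, x j.succ = y j.succ := fun j => congrFun h1 j
      by_cases h3 : x 0 = y 0
      · rw [if_pos h1, if_pos h3, h3] at h
        by_cases h4 : iteratedKroneckerSum (lineMatrix n) d (Fin.tail x) (Fin.tail y) = 0
        · simp [h4, lineMatrix_apply] at h
        · have := ih _ _ h4
          simp only [Fin.tail] at this
          rw [this, h3]
          ring
      · simp only [h1, h3, if_true, if_false, add_zero, lineMatrix_apply, ne_eq,
          ite_eq_right_iff, one_ne_zero, imp_false, not_not] at h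
        simp only [h2]
        rcases h with h | h <;> rw [← h] <;> push_cast
        · ring
        · linear_combination -CharTwo.add_self_eq_zero (1 : ZMod 2)
    · by_cases h3 : x 0 = y 0
      · simp only [h1, h3, if_true, if_false, zero_add] at h
        have := ih _ _ h
        simp only [Fin.tail] at this
        rw [this, h3]
        ring
      · simp [h1, h3] at h

/-! ### The transition matrix of the automaton -/

theorem isNeighbor_cons {d n : ℕ} (a b : Fin n) (x y : Fin d → Fin n) :
    IsNeighbor (Fin.cons a x : Fin (d + 1) → Fin n) (Fin.cons b y) ↔
      ((a.val + 1 = b.val ∨ b.val + 1 = a.val) ∧ x = y) ∨ (a = b ∧ IsNeighbor x y) := by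
  simp only [IsNeighbor, Fin.exists_fin_succ, Fin.forall_fin_succ, Fin.cons_zero, Fin.cons_succ,
    ne_eq, not_true_eq_false, false_imp_iff, true_and, funext_iff, Fin.succ_ne_zero,
    not_false_eq_true, true_imp_iff, Fin.succ_inj, (Fin.succ_ne_zero _).symm]
  grind

open scoped Classical in
theorem iteratedKroneckerSum_lineMatrix_apply (n d : ℕ) (x y : Fin d → Fin n) :
    iteratedKroneckerSum (lineMatrix n) d x y = if IsNeighbor x y then 1 else 0 := by
  induction d with
  | zero => simp [iteratedKroneckerSum, IsNeighbor]
  | succ d ih =>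
    obtain ⟨a, x, rfl⟩ : ∃ a y, x = Fin.cons a y := ⟨x 0, Fin.tail x, (Fin.cons_self_tail x).symm⟩
    obtain ⟨b, y, rfl⟩ : ∃ a z, y = Fin.cons a z := ⟨y 0, Fin.tail y, (Fin.cons_self_tail y).symm⟩
    have hirr : ∀ z : Fin d → Fin n, ¬ IsNeighbor z z := by
      rintro z ⟨i, h, -⟩
      omega
    simp only [iteratedKroneckerSum_succ_apply, ih, Fin.tail_cons, Fin.cons_zero, isNeighbor_cons,
      lineMatrix_apply]
    by_cases h1 : a = b <;> by_cases h2 : x = y <;> simp [h1, h2, hirr]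

theorem lightsOutStep_eq_mulVec {n d : ℕ} (v : (Fin d → Fin n) → ZMod 2) :
    lightsOutStep v = (iteratedKroneckerSum (lineMatrix n) d).mulVec v := by
  funext x
  simp [lightsOutStep, Matrix.mulVec, dotProduct, iteratedKroneckerSum_lineMatrix_apply,
    Finset.sum_filter]

/-! ### The one-dimensional automaton by reflection -/

/-- Cell `y` carries `g (y + 1)`, so the missing neighbours of the two end cells sit at 0 and n + 1,
where `g` vanishes, and the ends need no separate formula. -/
theorem lineMatrix_map_mulVec {n : ℕ} {R : Type*} [CommRing R] [Algebra (ZMod 2) R] (g : ℕ → R)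
    (h0 : g 0 = 0) (hn : g (n + 1) = 0) (x : Fin n) :
    ((lineMatrix n).map (algebraMap (ZMod 2) R)).mulVec (fun y => g (y + 1)) x =
      g x + g (x + 2) := by
  have hterm : ∀ y : Fin n, ((lineMatrix n).map (algebraMap (ZMod 2) R)) x y * g (y + 1) =
      (if y.val + 1 = x.val then g (y.val + 1) else 0) +
      if x.val + 1 = y.val then g (y.val + 1) else 0 := by
    intro y
    rw [Matrix.map_apply, lineMatrix_apply]
    split_ifs <;> first | omega | simp
  simp only [Matrix.mulVec, dotProduct, hterm, Finset.sum_add_distrib]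
  congr 1
  · rcases Nat.eq_zero_or_pos x.val with hx | hx
    · rw [hx, h0]
      exact Finset.sum_eq_zero fun y _ => if_neg (by omega)
    · rw [Finset.sum_eq_single ⟨x.val - 1, by omega⟩]
      · rw [if_pos (by simp; omega)]
        congr 1
        simp; omega
      · intro y _ hy
        rw [if_neg]
        rintro h
        exact hy (Fin.ext (by simp; omega))
      · simp
  · rcases Nat.lt_or_ge (x.val + 1) n with hx | hx
    · rw [Finset.sum_eq_single ⟨x.val + 1, hx⟩]
      · simp
      · intro y _ hy
        rw [if_neg]
        rintro h
        exact hy (Fin.ext (by simp; omega))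
      · simp
    · rw [show x.val + 2 = n + 1 by omega, hn]
      exact Finset.sum_eq_zero fun y _ => if_neg (by omega)

/-- The sequence on `ℤ` obtained from a vector on `{1, …, n}` by repeated reflection at the
multiples of `n + 1`. -/
def reflectExtend {n : ℕ} (v : Fin n → ZMod 2) (k : ℤ) : ZMod 2 :=
  -- The condition `0 < j` is needed since `0 - 1 = 0` in `ℕ`; the mirrors 0 and n + 1 get the value
  -- 0.
  let g : ℕ → ZMod 2 := fun j => if h : j - 1 < n ∧ 0 < j then v ⟨j - 1, h.1⟩ else 0
  g (min (k % (2 * (n + 1))) (2 * (n + 1) - k % (2 * (n + 1)))).toNat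

/-- The sum of the two neighbouring values of a sequence on `ℤ`. -/
def neighborSum (f : ℤ → ZMod 2) (k : ℤ) : ZMod 2 :=
  f (k - 1) + f (k + 1)

theorem reflectExtend_injective {n : ℕ} :
    Function.Injective (reflectExtend : (Fin n → ZMod 2) → ℤ → ZMod 2) := by
  intro v w h
  funext x
  have hx := congrFun h (x.val + 1)
  have h1 : ((x.val : ℤ) + 1) % (2 * (n + 1)) = x.val + 1 :=
    Int.emod_eq_of_lt (by omega) (by omega)
  have h2 : (min ((x.val : ℤ) + 1) (2 * (n + 1) - (x.val + 1))).toNat = x.val + 1 := by omega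
  simpa only [reflectExtend, h1, h2, Nat.add_sub_cancel, x.isLt, Nat.succ_pos, and_self, dif_pos]
    using hx

theorem reflectExtend_add_period {n : ℕ} (v : Fin n → ZMod 2) (k q : ℤ) :
    reflectExtend v (k + 2 * (n + 1) * q) = reflectExtend v k := by
  simp only [reflectExtend, Int.add_mul_emod_self_left]

theorem reflectExtend_mulVec {n : ℕ} (v : Fin n → ZMod 2) :
    reflectExtend ((lineMatrix n).mulVec v) = neighborSum (reflectExtend v) := by
  set g : ℕ → ZMod 2 := fun j => if h : j - 1 < n ∧ 0 < j then v ⟨j - 1, h.1⟩ else 0 with hg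
  have hg0 : g 0 = 0 := by simp [hg]
  have hgn : g (n + 1) = 0 := by simp [hg]
  have hv : (fun y : Fin n => g (y + 1)) = v := by
    funext y
    simp [hg]
  have hA : ∀ x : Fin n, (lineMatrix n).mulVec v x = g x + g (x + 2) := by
    intro x
    have := lineMatrix_map_mulVec g hg0 hgn x
    rwa [hv, Algebra.algebraMap_self, RingHom.coe_id, Matrix.map_id] at this
  have hext : ∀ k, reflectExtend v k =
      g (min (k % (2 * (n + 1))) (2 * (n + 1) - k % (2 * (n + 1)))).toNat := fun k => rfl
  funext k
  rw [neighborSum, hext, hext]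
  have hr0 := Int.emod_nonneg k (b := 2 * (n + 1)) (by omega)
  have hr1 := Int.emod_lt_of_pos k (b := 2 * ((n : ℤ) + 1)) (by omega)
  have hk := Int.emod_add_mul_ediv k (2 * ((n : ℤ) + 1))
  have hm : (k - 1) % (2 * ((n : ℤ) + 1)) =
      if k % (2 * ((n : ℤ) + 1)) = 0 then 2 * (n : ℤ) + 1 else k % (2 * ((n : ℤ) + 1)) - 1 := by
    generalize k % (2 * ((n : ℤ) + 1)) = r, k / (2 * ((n : ℤ) + 1)) = q at *
    split_ifs with h
    · rw [show k - 1 = 2 * (n : ℤ) + 1 + 2 * (n + 1) * (q - 1) by linear_combination h - hk,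
        Int.add_mul_emod_self_left, Int.emod_eq_of_lt] <;> omega
    · rw [show k - 1 = r - 1 + 2 * (n + 1) * q by linear_combination -hk,
        Int.add_mul_emod_self_left, Int.emod_eq_of_lt] <;> omega
  have hp : (k + 1) % (2 * ((n : ℤ) + 1)) =
      if k % (2 * ((n : ℤ) + 1)) = 2 * n + 1 then 0 else k % (2 * ((n : ℤ) + 1)) + 1 := by
    generalize k % (2 * ((n : ℤ) + 1)) = r, k / (2 * ((n : ℤ) + 1)) = q at *
    split_ifs with h
    · rw [show k + 1 = 0 + 2 * (n + 1) * (q + 1) by linear_combination h - hk,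
        Int.add_mul_emod_self_left, Int.zero_emod]
    · rw [show k + 1 = r + 1 + 2 * (n + 1) * q by linear_combination -hk,
        Int.add_mul_emod_self_left, Int.emod_eq_of_lt] <;> omega
  rw [hm, hp, reflectExtend]
  dsimp only
  clear hm hp hk
  generalize k % (2 * ((n : ℤ) + 1)) = r at *
  -- At the mirrors r = 0 and r = n + 1 the two neighbours are reflections of each other, so their
  -- sum is 0.
  by_cases h0 : r = 0
  · subst h0
    have h1 : (min (2 * (n : ℤ) + 1) (2 * (n + 1) - (2 * n + 1))).toNat = 1 := by omega
    have h2 : (min (0 + 1 : ℤ) (2 * (n + 1) - (0 + 1))).toNat = 1 := by omega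
    have h3 : (min (0 : ℤ) (2 * (n + 1) - 0)).toNat = 0 := by omega
    rw [if_pos rfl, if_neg (by omega), h1, h2, h3, CharTwo.add_self_eq_zero]
    simp
  by_cases hb : r = n + 1
  · subst hb
    have h1 : (min ((n : ℤ) + 1 - 1) (2 * (n + 1) - (n + 1 - 1))).toNat = n := by omega
    have h2 : (min ((n : ℤ) + 1 + 1) (2 * (n + 1) - (n + 1 + 1))).toNat = n := by omega
    have h3 : (min ((n : ℤ) + 1) (2 * (n + 1) - (n + 1))).toNat = n + 1 := by omega
    rw [if_neg h0, h3]
    -- For n = 0 the mirror n + 1 is also the last residue 2n + 1, where `hp` wraps around.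
    by_cases hn : n = 0
    · subst hn
      simp [hg]
    rw [if_neg (by omega), h1, h2, CharTwo.add_self_eq_zero]
    simp
  obtain ⟨x, hx⟩ : ∃ x : Fin n, (min r (2 * (n + 1) - r)).toNat = x.val + 1 :=
    ⟨⟨(min r (2 * (n + 1) - r)).toNat - 1, by omega⟩, by simp; omega⟩
  rw [hx, dif_pos ⟨by omega, by omega⟩]
  simp only [Nat.add_sub_cancel, Fin.eta]
  rw [hA, if_neg h0]
  rcases lt_or_gt_of_ne hb with hlt | hgt
  · rw [if_neg (by omega)]
    congr 2 <;> omega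
  -- On the reflected half, left and right neighbours are exchanged.
  · rw [add_comm]
    congr 2
    · omega
    · split_ifs <;> omega

theorem reflectExtend_pow_mulVec {n : ℕ} (v : Fin n → ZMod 2) (m : ℕ) :
    reflectExtend ((lineMatrix n ^ m).mulVec v) = neighborSum^[m] (reflectExtend v) := by
  induction m generalizing v with
  | zero => simp
  | succ m ih => rw [pow_succ, ← Matrix.mulVec_mulVec, ih, reflectExtend_mulVec,
      Function.iterate_succ_apply]

theorem neighborSum_iterate_two_pow (j : ℕ) (f : ℤ → ZMod 2) (k : ℤ) :
    neighborSum^[2 ^ j] f k = f (k - 2 ^ j) + f (k + 2 ^ j) := by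
  induction j generalizing f k with
  | zero => simp [neighborSum]
  | succ j ih =>
    rw [pow_succ, mul_two, Function.iterate_add_apply, ih, ih, ih, pow_succ, mul_two,
      sub_add_cancel, add_sub_cancel_right, sub_sub, add_assoc k]
    linear_combination CharTwo.add_self_eq_zero (f k)

/-- Doubling turns 2^s ≡ ±1 mod n + 1 into 2^(s+1) ≡ ±2 modulo the period 2(n + 1). The sign only
swaps the two shifted copies. -/
theorem lineMatrix_pow_two_pow {n s : ℕ}
    (hs : (2 : ZMod (n + 1)) ^ s = 1 ∨ (2 : ZMod (n + 1)) ^ s = -1) :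
    lineMatrix n ^ 2 ^ (s + 1) = lineMatrix n ^ 2 := by
  have hper : ∀ (v : Fin n → ZMod 2) (a b q : ℤ), a = b + 2 * (n + 1) * q →
      reflectExtend v a = reflectExtend v b := by
    rintro v a b q rfl
    exact reflectExtend_add_period v b q
  refine Matrix.mulVec_injective (funext fun v => reflectExtend_injective ?_)
  rw [reflectExtend_pow_mulVec, reflectExtend_pow_mulVec]
  funext k
  have h2 := neighborSum_iterate_two_pow 1 (reflectExtend v) k
  rw [pow_one, pow_one] at h2
  rw [neighborSum_iterate_two_pow, h2]
  rcases hs with h | h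
  · obtain ⟨q, hq⟩ : ((n + 1 : ℕ) : ℤ) ∣ 2 ^ s - 1 := by
      rw [← ZMod.intCast_zmod_eq_zero_iff_dvd]
      push_cast
      rw [h, sub_self]
    push_cast at hq
    rw [hper v (k - 2 ^ (s + 1)) (k - 2) (-q) (by rw [pow_succ]; linear_combination -2 * hq),
      hper v (k + 2 ^ (s + 1)) (k + 2) q (by rw [pow_succ]; linear_combination 2 * hq)]
  · obtain ⟨q, hq⟩ : ((n + 1 : ℕ) : ℤ) ∣ 2 ^ s + 1 := by
      rw [← ZMod.intCast_zmod_eq_zero_iff_dvd]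
      push_cast
      rw [h, neg_add_cancel]
    push_cast at hq
    rw [hper v (k - 2 ^ (s + 1)) (k + 2) (-q) (by rw [pow_succ]; linear_combination -2 * hq),
      hper v (k + 2 ^ (s + 1)) (k - 2) q (by rw [pow_succ]; linear_combination 2 * hq), add_comm]

/-! ### Upper bounds on the cycle length -/

theorem sordTwo_spec {b : ℕ} (hb : Odd b) :
    0 < sordTwo b ∧ ((2 : ZMod b) ^ sordTwo b = 1 ∨ (2 : ZMod b) ^ sordTwo b = -1) := by
  refine Nat.sInf_mem (s := {j | 0 < j ∧ ((2 : ZMod b) ^ j = 1 ∨ (2 : ZMod b) ^ j = -1)})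
    ⟨b.totient, Nat.totient_pos.2 hb.pos, Or.inl ?_⟩
  have := (ZMod.natCast_eq_natCast_iff _ _ _).2
    (Nat.ModEq.pow_totient (Nat.coprime_two_left.2 hb))
  simpa using this

theorem sordTwo_le {b j : ℕ} (hj : 0 < j) (h : (2 : ZMod b) ^ j = 1 ∨ (2 : ZMod b) ^ j = -1) :
    sordTwo b ≤ j :=
  Nat.sInf_le ⟨hj, h⟩

theorem lightsOut_pow_eq {n : ℕ} (hn : Even n) (d : ℕ) :
    iteratedKroneckerSum (lineMatrix n) d ^ 2 =
      iteratedKroneckerSum (lineMatrix n) d ^ (2 + 2 * (2 ^ sordTwo (n + 1) - 1)) := by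
  have h := lineMatrix_pow_two_pow (n := n) (sordTwo_spec hn.add_one).2
  have h1 : 1 ≤ 2 ^ sordTwo (n + 1) := Nat.one_le_two_pow
  rw [show 2 + 2 * (2 ^ sordTwo (n + 1) - 1) = 2 ^ (sordTwo (n + 1) + 1) by rw [pow_succ]; omega,
    iteratedKroneckerSum_pow_two_pow, h, iteratedKroneckerSum_sq]

theorem lightsOutCycleLength_dvd {n : ℕ} (hn : Even n) (d : ℕ) :
    lightsOutCycleLength n d ∣ 2 * (2 ^ sordTwo (n + 1) - 1) :=
  cycleLength_dvd (lightsOut_pow_eq hn d)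

theorem exists_lightsOutCycleLength_le (n : ℕ) :
    ∃ C : ℕ, ∀ d : ℕ, 0 < lightsOutCycleLength n d ∧ lightsOutCycleLength n d ≤ C := by
  obtain ⟨a, c, hac, h⟩ : ∃ a c : ℕ, a < c ∧ lineMatrix n ^ 2 ^ a = lineMatrix n ^ 2 ^ c := by
    obtain ⟨a, c, hne, h⟩ := Finite.exists_ne_map_eq_of_infinite fun j : ℕ => lineMatrix n ^ 2 ^ j
    rcases lt_or_gt_of_ne hne with hlt | hlt
    exacts [⟨a, c, hlt, h⟩, ⟨c, a, hlt, h.symm⟩]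
  have hlt : 2 ^ a < 2 ^ c := Nat.pow_lt_pow_right one_lt_two hac
  refine ⟨2 ^ c - 2 ^ a, fun d => ?_⟩
  have hX : iteratedKroneckerSum (lineMatrix n) d ^ 2 ^ a =
      iteratedKroneckerSum (lineMatrix n) d ^ (2 ^ a + (2 ^ c - 2 ^ a)) := by
    rw [Nat.add_sub_of_le hlt.le, iteratedKroneckerSum_pow_two_pow,
      iteratedKroneckerSum_pow_two_pow, h]
  exact ⟨(cycleLength_mem (by omega) hX).1, Nat.le_of_dvd (by omega) (cycleLength_dvd hX)⟩

/-! ### Eigenvalues from roots of unity -/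

section Eigenvalues

variable {K : Type*} [Field K]

/-- The sequence z^j + z^(-j) satisfies the neighbour recurrence, and in characteristic 2 it
vanishes at j = 0 and j = n + 1. -/
theorem lineMatrix_map_mulVec_eigenvector [Algebra (ZMod 2) K] {n : ℕ} {z : K} (hz : z ^ (n + 1) = 1) :
    ((lineMatrix n).map (algebraMap (ZMod 2) K)).mulVec
        (fun y => z ^ (y.val + 1) + z⁻¹ ^ (y.val + 1)) =
      (z + z⁻¹) • fun y : Fin n => z ^ (y.val + 1) + z⁻¹ ^ (y.val + 1) := by
  have : CharP K 2 := charP_of_injective_algebraMap (algebraMap (ZMod 2) K).injective 2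
  have hz0 : z ≠ 0 := by
    rintro rfl
    simp at hz
  funext x
  rw [lineMatrix_map_mulVec (fun j => z ^ j + z⁻¹ ^ j)]
  · have h1 : z * z⁻¹ = 1 := mul_inv_cancel₀ hz0
    simp only [Pi.smul_apply, smul_eq_mul]
    linear_combination (-z ^ x.val - z⁻¹ ^ x.val) * h1
  · simp [CharTwo.add_self_eq_zero]
  · simp [inv_pow, hz, CharTwo.add_self_eq_zero]

/-- The sums of `d` eigenvalues `z + z⁻¹` of `A_n`, where `b = n + 1` and `z` runs over the
nontrivial `b`-th roots of unity. -/
def eigenvalueSums (K : Type*) [Field K] (b d : ℕ) : Set K :=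
  {x | ∃ z : Fin d → K, (∀ j, z j ^ b = 1 ∧ z j ≠ 1) ∧ ∑ j, (z j + (z j)⁻¹) = x}

theorem zero_mem_eigenvalueSums (b : ℕ) : (0 : K) ∈ eigenvalueSums K b 0 :=
  ⟨fun _ => 0, fun j => j.elim0, by simp⟩

theorem mem_eigenvalueSums_one {b : ℕ} {z : K} (hz : z ^ b = 1) (hz1 : z ≠ 1) :
    z + z⁻¹ ∈ eigenvalueSums K b 1 :=
  ⟨fun _ => z, fun _ => ⟨hz, hz1⟩, by simp⟩

theorem add_mem_eigenvalueSums {b d e : ℕ} {x y : K} (hx : x ∈ eigenvalueSums K b d)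
    (hy : y ∈ eigenvalueSums K b e) : x + y ∈ eigenvalueSums K b (d + e) := by
  obtain ⟨z, hz, rfl⟩ := hx
  obtain ⟨w, hw, rfl⟩ := hy
  refine ⟨Fin.append z w, fun j => ?_, by simp [Fin.sum_univ_add]⟩
  refine Fin.addCases (fun i => ?_) (fun i => ?_) j
  · simpa using hz i
  · simpa using hw i

theorem eigenvalueSums_add_even [CharP K 2] {b d e : ℕ} (he : Even e) {x ζ : K}
    (hζ : ζ ^ b = 1) (hζ1 : ζ ≠ 1) (hx : x ∈ eigenvalueSums K b d) :
    x ∈ eigenvalueSums K b (d + e) := by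
  obtain ⟨k, rfl⟩ := he
  refine ⟨Fin.append hx.choose fun _ => ζ, fun j => ?_, ?_⟩
  · refine Fin.addCases (fun i => ?_) (fun i => ?_) j
    · simpa using hx.choose_spec.1 i
    · simpa using ⟨hζ, hζ1⟩
  · simp [Fin.sum_univ_add, hx.choose_spec.2, CharTwo.add_self_eq_zero]

theorem eq_or_mul_eq_one_of_add_inv_eq [CharP K 2] {y z : K} (hy : y ≠ 0) (hz : z ≠ 0)
    (h : y + y⁻¹ = z + z⁻¹) : y = z ∨ y * z = 1 := by
  have : (y - z) * (y * z - 1) = 0 := by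
    field_simp at h
    linear_combination h
  rcases mul_eq_zero.1 this with h | h
  · exact Or.inl (sub_eq_zero.1 h)
  · exact Or.inr (sub_eq_zero.1 h)

theorem add_inv_ne_zero [CharP K 2] {b : ℕ} (hb : Odd b) {z : K} (hz : z ^ b = 1) (hz1 : z ≠ 1) :
    z + z⁻¹ ≠ 0 := by
  intro h
  have hz0 : z ≠ 0 := by
    rintro rfl
    simp [hb.pos.ne'] at hz
  rcases eq_or_mul_eq_one_of_add_inv_eq hz0 one_ne_zero
    (h.trans (by rw [inv_one, CharTwo.add_self_eq_zero])) with h | h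
  · exact hz1 h
  · exact hz1 (by simpa using h)

/-- Every sum of `d` eigenvalues of `A_n` is an eigenvalue of the transition matrix. -/
theorem exists_eigenvector [Algebra (ZMod 2) K] {n d : ℕ}
    (hn : Even n) {x : K}
    (hx : x ∈ eigenvalueSums K (n + 1) d) :
    ∃ w : (Fin d → Fin n) → K, w ≠ 0 ∧
      ((iteratedKroneckerSum (lineMatrix n) d).map (algebraMap (ZMod 2) K)).mulVec w = x • w := by
  have : CharP K 2 := charP_of_injective_algebraMap (algebraMap (ZMod 2) K).injective 2
  obtain ⟨z, hz, rfl⟩ := hx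
  refine ⟨fun x => ∏ j, (z j ^ ((x j).val + 1) + (z j)⁻¹ ^ ((x j).val + 1)), ?_, ?_⟩
  · rcases Nat.eq_zero_or_pos d with rfl | hd
    · intro h
      simpa using congrFun h Fin.elim0
    have hn0 : 0 < n := by
      rcases Nat.eq_zero_or_pos n with rfl | h
      · exact absurd (by simpa using (hz ⟨0, hd⟩).1) (hz ⟨0, hd⟩).2
      · exact h
    intro h
    -- At the corner cell the product vector takes the value ∏ (z_j + z_j⁻¹), which is nonzero
    -- because n + 1 is odd.
    have h0 := congrFun h fun _ => ⟨0, hn0⟩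
    simp only [zero_add, pow_one, Pi.zero_apply, Finset.prod_eq_zero_iff] at h0
    obtain ⟨j, -, hj⟩ := h0
    exact add_inv_ne_zero hn.add_one (hz j).1 (hz j).2 hj
  · rw [iteratedKroneckerSum_map (algebraMap (ZMod 2) K)]
    exact iteratedKroneckerSum_mulVec_prod _ d
      (fun j (y : Fin n) => z j ^ (y.val + 1) + (z j)⁻¹ ^ (y.val + 1)) _
      fun j => lineMatrix_map_mulVec_eigenvector (hz j).1

theorem Matrix.pow_mulVec_of_eigenvector {ι R : Type*} [Fintype ι] [DecidableEq ι] [CommRing R]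
    {M : Matrix ι ι R} {w : ι → R} {x : R} (h : M.mulVec w = x • w) (k : ℕ) :
    (M ^ k).mulVec w = x ^ k • w := by
  induction k with
  | zero => simp
  | succ k ih => rw [pow_succ, ← Matrix.mulVec_mulVec, h, Matrix.mulVec_smul, ih, smul_smul,
      pow_succ, mul_comm]

theorem two_dvd_and_pow_eq_one [Algebra (ZMod 2) K] {n d i k : ℕ} (hn : Even n)
    {x : K}
    (hx : x ∈ eigenvalueSums K (n + 1) d) (hx0 : x ≠ 0)
    (h : iteratedKroneckerSum (lineMatrix n) d ^ k =
      iteratedKroneckerSum (lineMatrix n) d ^ (k + i)) : 2 ∣ i ∧ x ^ i = 1 := by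
  obtain ⟨w, hw, hXw⟩ := exists_eigenvector hn hx
  obtain ⟨y, hy⟩ := Function.ne_iff.1 hw
  have hmap : ∀ m, ((iteratedKroneckerSum (lineMatrix n) d ^ m).map
      (algebraMap (ZMod 2) K)).mulVec w = x ^ m • w := by
    intro m
    rw [Matrix.map_pow]
    exact Matrix.pow_mulVec_of_eigenvector hXw m
  constructor
  · by_contra hi
    have h0 := Matrix.pow_eq_zero_of_grading _ (iteratedKroneckerSum_lineMatrix_grading n d) h hi
    have hk := hmap k
    rw [h0, Matrix.map_zero _ (map_zero _), Matrix.zero_mulVec] at hk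
    exact mul_ne_zero (pow_ne_zero k hx0) hy (congrFun hk y).symm
  · have hk := congrFun ((hmap k).symm.trans (h ▸ hmap (k + i))) y
    simp only [Pi.smul_apply, smul_eq_mul] at hk
    have := mul_right_cancel₀ hy hk
    rw [pow_add] at this
    exact (mul_left_cancel₀ (pow_ne_zero k hx0) (by rw [mul_one, ← this]))

theorem two_dvd_lightsOutCycleLength_and_pow_eq_one [Algebra (ZMod 2) K] {n d : ℕ}
    (hn : Even n) {x : K}
    (hx : x ∈ eigenvalueSums K (n + 1) d) (hx0 : x ≠ 0) :
    2 ∣ lightsOutCycleLength n d ∧ x ^ lightsOutCycleLength n d = 1 := by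
  have hs : 1 < 2 ^ sordTwo (n + 1) :=
    Nat.one_lt_two_pow (sordTwo_spec hn.add_one).1.ne'
  obtain ⟨-, k, hk⟩ := cycleLength_mem (by omega) (lightsOut_pow_eq hn d)
  exact two_dvd_and_pow_eq_one hn hx hx0 hk

theorem add_inv_pow_two_pow [CharP K 2] {b s : ℕ}
    (hs : (2 : ZMod b) ^ s = 1 ∨ (2 : ZMod b) ^ s = -1) {z : K} (hz : z ^ b = 1) :
    (z + z⁻¹) ^ 2 ^ s = z + z⁻¹ := by
  rw [add_pow_char_pow, inv_pow]
  rcases hs with h | h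
  · have : 2 ^ s ≡ 1 [MOD b] := (ZMod.natCast_eq_natCast_iff _ _ _).1 (by simpa using h)
    rw [pow_eq_pow_of_modEq this hz, pow_one]
  · have : b ∣ 2 ^ s + 1 := by
      rw [← ZMod.natCast_eq_zero_iff]
      push_cast
      rw [h, neg_add_cancel]
    have h1 : z ^ 2 ^ s * z = 1 := by
      rw [← pow_succ]
      exact orderOf_dvd_iff_pow_eq_one.1 ((orderOf_dvd_of_pow_eq_one hz).trans this)
    rw [eq_inv_of_mul_eq_one_left h1, inv_inv, add_comm]

theorem eigenvalueSums_pow_two_pow [CharP K 2] {b s d : ℕ}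
    (hs : (2 : ZMod b) ^ s = 1 ∨ (2 : ZMod b) ^ s = -1) {x : K} (hx : x ∈ eigenvalueSums K b d) :
    x ^ 2 ^ s = x := by
  obtain ⟨z, hz, rfl⟩ := hx
  rw [sum_pow_char_pow]
  exact Finset.sum_congr rfl fun j _ => add_inv_pow_two_pow hs (hz j).1

/-- Since y + y⁻¹ determines y up to inversion, a Frobenius power fixing ζ + ζ⁻¹ sends ζ to ζ or
ζ⁻¹. This bounds the degree of ζ + ζ⁻¹ below by `sordTwo b`. -/
theorem two_pow_eq_of_add_inv_pow [CharP K 2] {b m : ℕ} {ζ : K} (hb : 0 < b)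
    (hζ : IsPrimitiveRoot ζ b) (h : (ζ + ζ⁻¹) ^ 2 ^ m = ζ + ζ⁻¹) :
    (2 : ZMod b) ^ m = 1 ∨ (2 : ZMod b) ^ m = -1 := by
  have hζ0 := hζ.ne_zero hb.ne'
  rw [add_pow_char_pow, inv_pow] at h
  rcases eq_or_mul_eq_one_of_add_inv_eq (pow_ne_zero _ hζ0) hζ0 h with h | h
  · left
    have h1 : ζ ^ 2 ^ m = ζ ^ 1 := by rw [h, pow_one]
    have : IsOfFinOrder ζ := isOfFinOrder_iff_pow_eq_one.2 ⟨b, hb, hζ.pow_eq_one⟩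
    rw [this.pow_eq_pow_iff_modEq, ← hζ.eq_orderOf, ← ZMod.natCast_eq_natCast_iff] at h1
    simpa using h1
  · right
    rw [← pow_succ, hζ.pow_eq_one_iff_dvd, ← ZMod.natCast_eq_zero_iff] at h
    push_cast at h
    exact eq_neg_of_add_eq_zero_left h

end Eigenvalues

theorem exists_isPrimitiveRoot_of_odd {b : ℕ} (hb : Odd b) :
    ∃ ζ : AlgebraicClosure (ZMod 2), IsPrimitiveRoot ζ b := by
  have : NeZero (b : AlgebraicClosure (ZMod 2)) := ⟨by
    rw [Ne, CharP.cast_eq_zero_iff _ 2]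
    exact hb.not_two_dvd_nat⟩
  exact HasEnoughRootsOfUnity.exists_primitiveRoot _ _

theorem monic_X_pow_two_pow_sub_X {R : Type*} [CommRing R] [Nontrivial R] {s : ℕ} (hs : 0 < s) :
    (Polynomial.X ^ 2 ^ s - Polynomial.X : Polynomial R).Monic := by
  refine Polynomial.monic_X_pow_sub ?_
  rw [Polynomial.degree_X]
  exact_mod_cast Nat.one_lt_two_pow hs.ne'

/-! ### Counting the eigenvalue sums -/

section Counting

variable {K : Type*} [Field K]

/-- By (z + z⁻¹)(ζ + ζ⁻¹) = (zζ + (zζ)⁻¹) + (zζ⁻¹ + (zζ⁻¹)⁻¹), additive combinations already absorb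
products. -/
theorem mul_mem_closure_of_add_inv {b : ℕ} {ζ x : K} (hζ : ζ ^ b = 1)
    (hx : x ∈ AddSubmonoid.closure {x : K | ∃ z, z ^ b = 1 ∧ z + z⁻¹ = x}) :
    x * (ζ + ζ⁻¹) ∈ AddSubmonoid.closure {x : K | ∃ z, z ^ b = 1 ∧ z + z⁻¹ = x} := by
  induction hx using AddSubmonoid.closure_induction with
  | zero => simp
  | mem x hx =>
    obtain ⟨z, hz, rfl⟩ := hx
    rw [show (z + z⁻¹) * (ζ + ζ⁻¹) = (z * ζ + (z * ζ)⁻¹) + (z * ζ⁻¹ + (z * ζ⁻¹)⁻¹) by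
      rw [mul_inv, mul_inv, inv_inv]; ring]
    exact add_mem (AddSubmonoid.subset_closure ⟨_, by rw [mul_pow, hz, hζ, one_mul], rfl⟩)
      (AddSubmonoid.subset_closure ⟨_, by rw [mul_pow, inv_pow, hz, hζ, inv_one, one_mul], rfl⟩)
  | add x y _ _ hx hy =>
    rw [add_mul]
    exact add_mem hx hy

theorem ncard_setOf_pow_eq_one_le {g : ℕ} (hg : 0 < g) : {x : K | x ^ g = 1}.ncard ≤ g := by
  classical
  have : {x : K | x ^ g = 1} = ((Polynomial.nthRoots g (1 : K)).toFinset : Set K) := by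
    ext x
    simp [Polynomial.mem_nthRoots hg]
  rw [this, Set.ncard_coe_finset]
  exact (Multiset.toFinset_card_le _).trans (Polynomial.card_nthRoots g 1)

variable [CharP K 2]

/-- Pairs of equal terms cancel, so a sum can be padded to any larger length of the same parity; for
the other parity one extra ζ + ζ⁻¹ remains. Terms with z = 1 are 0 and can be dropped. -/
theorem mem_closure_eventually_mem_eigenvalueSums {b : ℕ} {ζ : K} (hζ : ζ ^ b = 1) (hζ1 : ζ ≠ 1)
    {x : K} (hx : x ∈ AddSubmonoid.closure {x : K | ∃ z, z ^ b = 1 ∧ z + z⁻¹ = x}) :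
    ∀ᶠ d in Filter.atTop,
      x ∈ eigenvalueSums K b d ∨ x + (ζ + ζ⁻¹) ∈ eigenvalueSums K b d := by
  have hθ := mem_eigenvalueSums_one hζ hζ1
  have h0 : ∀ d, (0 : K) ∈ eigenvalueSums K b d ∨ ζ + ζ⁻¹ ∈ eigenvalueSums K b d := by
    intro d
    rcases Nat.even_or_odd' d with ⟨k, rfl | rfl⟩
    · left
      simpa using eigenvalueSums_add_even (even_two_mul k) hζ hζ1 (zero_mem_eigenvalueSums b)
    · right
      rw [add_comm (2 * k)]
      exact eigenvalueSums_add_even (even_two_mul k) hζ hζ1 hθ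
  induction hx using AddSubmonoid.closure_induction with
  | zero => exact Filter.Eventually.of_forall fun d => by simpa using h0 d
  | mem x hx =>
    obtain ⟨z, hz, rfl⟩ := hx
    by_cases hz1 : z = 1
    · subst hz1
      exact Filter.Eventually.of_forall fun d => by
        simpa [CharTwo.add_self_eq_zero] using h0 d
    filter_upwards [Filter.eventually_ge_atTop 1] with d hd
    obtain ⟨e, rfl⟩ := Nat.exists_eq_add_of_le hd
    have h1 := mem_eigenvalueSums_one hz hz1
    rcases h0 e with h | h
    · left
      simpa using add_mem_eigenvalueSums h1 h
    · right
      exact add_mem_eigenvalueSums h1 h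
  | add x y _ _ hx hy =>
    obtain ⟨D, hD⟩ := Filter.eventually_atTop.1 hx
    obtain ⟨E, hE⟩ := Filter.eventually_atTop.1 hy
    filter_upwards [Filter.eventually_ge_atTop (D + E)] with d hd
    obtain ⟨e, rfl⟩ := Nat.exists_eq_add_of_le hd
    rw [add_assoc]
    have hc := CharTwo.add_self_eq_zero (ζ + ζ⁻¹)
    rcases hD D le_rfl with h1 | h1 <;> rcases hE (E + e) (by omega) with h2 | h2 <;>
      have h3 := add_mem_eigenvalueSums h1 h2
    · exact Or.inl h3
    · exact Or.inr (by convert h3 using 1; ring)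
    · exact Or.inr (by convert h3 using 1; ring)
    · exact Or.inl (by convert h3 using 1; linear_combination -hc)

theorem adjoin_le_closure [Algebra (ZMod 2) K] {b : ℕ} (hb : Odd b) {ζ : K}
    (hζ : ζ ^ b = 1) (hζ1 : ζ ≠ 1) {x : K} (hx : x ∈ IntermediateField.adjoin (ZMod 2) {ζ + ζ⁻¹}) :
    x ∈ AddSubmonoid.closure {x : K | ∃ z, z ^ b = 1 ∧ z + z⁻¹ = x} := by
  obtain ⟨hs0, hs⟩ := sordTwo_spec hb
  have hs1 : 1 < 2 ^ sordTwo b := Nat.one_lt_two_pow hs0.ne'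
  have hfrob := add_inv_pow_two_pow hs hζ
  have hint : IsIntegral (ZMod 2) (ζ + ζ⁻¹) := by
    refine ⟨Polynomial.X ^ 2 ^ sordTwo b - Polynomial.X,
      monic_X_pow_two_pow_sub_X hs0, by simp [hfrob]⟩
  have hpow : ∀ k, (ζ + ζ⁻¹) ^ (k + 1) ∈
      AddSubmonoid.closure {x : K | ∃ z, z ^ b = 1 ∧ z + z⁻¹ = x} := by
    intro k
    induction k with
    | zero => exact AddSubmonoid.subset_closure ⟨ζ, hζ, by simp⟩
    | succ k ih =>
      rw [pow_succ]
      exact mul_mem_closure_of_add_inv hζ ih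
  have h1 : (1 : K) ∈ AddSubmonoid.closure {x : K | ∃ z, z ^ b = 1 ∧ z + z⁻¹ = x} := by
    -- The exponent becomes 2^s - 1, and θ^(2^s) = θ ≠ 0 makes that power of θ = ζ + ζ⁻¹ equal to 1.
    have h := hpow (2 ^ sordTwo b - 2)
    have : (ζ + ζ⁻¹) ^ (2 ^ sordTwo b - 2 + 1) = 1 := by
      apply mul_right_cancel₀ (add_inv_ne_zero hb hζ hζ1)
      rw [← pow_succ, show 2 ^ sordTwo b - 2 + 1 + 1 = 2 ^ sordTwo b by omega, hfrob, one_mul]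
    rwa [this] at h
  rw [← IntermediateField.mem_toSubalgebra,
    IntermediateField.adjoin_simple_toSubalgebra_of_isAlgebraic hint.isAlgebraic,
    Algebra.adjoin_singleton_eq_range_aeval] at hx
  obtain ⟨p, rfl⟩ := hx
  have hC : ∀ (a : ZMod 2) (y : K),
      y ∈ AddSubmonoid.closure {x : K | ∃ z, z ^ b = 1 ∧ z + z⁻¹ = x} →
      algebraMap (ZMod 2) K a * y ∈
        AddSubmonoid.closure {x : K | ∃ z, z ^ b = 1 ∧ z + z⁻¹ = x} := by
    intro a y hy
    obtain rfl | rfl : a = 0 ∨ a = 1 := by revert a; decide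
    · simp
    · simpa using hy
  induction p using Polynomial.induction_on with
  | C a => simpa using hC a 1 h1
  | add p q hp hq =>
    rw [map_add]
    exact add_mem hp hq
  | monomial k a _ => simpa using hC a _ (hpow k)

theorem two_pow_sordTwo_le_card_adjoin [Algebra (ZMod 2) K] {b : ℕ} (hb : Odd b) {ζ : K}
    (hζ : IsPrimitiveRoot ζ b) :
    Finite (IntermediateField.adjoin (ZMod 2) {ζ + ζ⁻¹}) ∧
      2 ^ sordTwo b ≤ Nat.card (IntermediateField.adjoin (ZMod 2) {ζ + ζ⁻¹}) := by
  obtain ⟨hs0, hs⟩ := sordTwo_spec hb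
  have hint : IsIntegral (ZMod 2) (ζ + ζ⁻¹) :=
    ⟨Polynomial.X ^ 2 ^ sordTwo b - Polynomial.X,
      monic_X_pow_two_pow_sub_X hs0,
      by simp [add_inv_pow_two_pow hs hζ.pow_eq_one]⟩
  have := IntermediateField.adjoin.finiteDimensional hint
  have hfin : Finite (IntermediateField.adjoin (ZMod 2) {ζ + ζ⁻¹}) :=
    Module.finite_of_finite (ZMod 2)
  refine ⟨hfin, ?_⟩
  have := Fintype.ofFinite (IntermediateField.adjoin (ZMod 2) {ζ + ζ⁻¹})
  have hcard := FiniteField.pow_finrank_eq_card 2 (IntermediateField.adjoin (ZMod 2) {ζ + ζ⁻¹})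
  rw [Nat.card_eq_fintype_card, ← hcard]
  refine Nat.pow_le_pow_right two_pos (sordTwo_le Module.finrank_pos ?_)
  refine two_pow_eq_of_add_inv_pow hb.pos hζ ?_
  have h := congrArg Subtype.val (FiniteField.pow_card
    (IntermediateField.AdjoinSimple.gen (ZMod 2) (ζ + ζ⁻¹)))
  rwa [← hcard] at h

theorem finite_eigenvalueSums {b : ℕ} (hb : Odd b) (d : ℕ) : (eigenvalueSums K b d).Finite := by
  obtain ⟨hs0, hs⟩ := sordTwo_spec hb
  have hne : (Polynomial.X ^ 2 ^ sordTwo b - Polynomial.X : Polynomial K) ≠ 0 :=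
    (monic_X_pow_two_pow_sub_X hs0).ne_zero
  refine (Polynomial.finite_setOfPred_isRoot hne).subset fun x hx => ?_
  simp [eigenvalueSums_pow_two_pow hs hx]

theorem eventually_two_pow_sordTwo_le_ncard [Algebra (ZMod 2) K] {b : ℕ} (hb : Odd b) {ζ : K}
    (hζ : IsPrimitiveRoot ζ b) (hb1 : b ≠ 1) :
    ∀ᶠ d in Filter.atTop, 2 ^ sordTwo b ≤ 2 * (eigenvalueSums K b d).ncard := by
  have hζ1 : ζ ≠ 1 := hζ.ne_one (by have := hb.pos; omega)
  obtain ⟨hfin, hle⟩ := two_pow_sordTwo_le_card_adjoin hb hζ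
  have hfin' : (IntermediateField.adjoin (ZMod 2) {ζ + ζ⁻¹} : Set K).Finite := Set.toFinite _
  have hev := (Filter.eventually_all_finite hfin').2 fun x hx =>
    mem_closure_eventually_mem_eigenvalueSums hζ.pow_eq_one hζ1
      (adjoin_le_closure hb hζ.pow_eq_one hζ1 hx)
  filter_upwards [hev] with d hd
  refine hle.trans ?_
  have hS := finite_eigenvalueSums (K := K) hb d
  have hsub : (IntermediateField.adjoin (ZMod 2) {ζ + ζ⁻¹} : Set K) ⊆
      eigenvalueSums K b d ∪ (fun x => x + (ζ + ζ⁻¹)) '' eigenvalueSums K b d := by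
    intro x hx
    rcases hd x hx with h | h
    · exact Or.inl h
    · exact Or.inr ⟨_, h, by
        simp only [add_assoc x, CharTwo.add_self_eq_zero (ζ + ζ⁻¹), add_zero]⟩
  calc Nat.card (IntermediateField.adjoin (ZMod 2) {ζ + ζ⁻¹})
      = (IntermediateField.adjoin (ZMod 2) {ζ + ζ⁻¹} : Set K).ncard := Nat.card_coe_set_eq _
    _ ≤ _ := Set.ncard_le_ncard hsub (hS.union (hS.image _))
    _ ≤ _ := Set.ncard_union_le _ _
    _ ≤ _ := by
      have := Set.ncard_image_le (f := fun x => x + (ζ + ζ⁻¹)) hS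
      omega

end Counting

/-! ### The maximum is attained in high dimension -/

theorem three_le_sordTwo {b : ℕ} (hb : Odd b) (h7 : 7 ≤ b) : 3 ≤ sordTwo b := by
  obtain ⟨h0, h⟩ := sordTwo_spec hb
  by_contra! hlt
  have hdvd : b ∣ 2 ^ sordTwo b - 1 ∨ b ∣ 2 ^ sordTwo b + 1 := by
    rw [← ZMod.natCast_eq_zero_iff, ← ZMod.natCast_eq_zero_iff,
      Nat.cast_sub Nat.one_le_two_pow]
    push_cast
    exact h.imp (fun h => by rw [h, sub_self]) fun h => by rw [h, neg_add_cancel]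
  generalize sordTwo b = s at *
  have hs : s = 1 ∨ s = 2 := by omega
  rcases hs with rfl | rfl <;> rcases hdvd with h | h <;>
    exact absurd (Nat.le_of_dvd (by norm_num) h) (by norm_num; omega)

/-- The cofactor is odd, since 2^s - 1 is, and a cofactor of at least 3 would give g ≤ 1 and 2^s ≤
4. -/
theorem eq_of_dvd_two_pow_sub_one {g s : ℕ} (hs : 3 ≤ s) (hg : g ∣ 2 ^ s - 1)
    (hle : 2 ^ s ≤ 2 * (g + 1)) : g = 2 ^ s - 1 := by
  obtain ⟨q, hq⟩ := hg
  have h8 : 2 ^ 3 ≤ 2 ^ s := Nat.pow_le_pow_right two_pos hs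
  obtain ⟨r, hr⟩ : 2 ∣ 2 ^ s := dvd_pow_self 2 (by omega)
  rcases Nat.lt_or_ge q 3 with h | h
  · interval_cases q <;> omega
  · have := Nat.mul_le_mul_left g h
    omega

theorem lightsOutCycleLength_eventually_eq {n : ℕ} (h6 : 6 ≤ n) (hn : Even n) :
    ∀ᶠ d in Filter.atTop, lightsOutCycleLength n d = 2 * (2 ^ sordTwo (n + 1) - 1) := by
  have hb := hn.add_one
  obtain ⟨ζ, hζ⟩ := exists_isPrimitiveRoot_of_odd hb
  have hs3 := three_le_sordTwo hb (by omega)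
  have h8 : 2 ^ 3 ≤ 2 ^ sordTwo (n + 1) := Nat.pow_le_pow_right two_pos hs3
  have : CharP (AlgebraicClosure (ZMod 2)) 2 := charP_of_injective_algebraMap
    (algebraMap (ZMod 2) (AlgebraicClosure (ZMod 2))).injective 2
  filter_upwards [eventually_two_pow_sordTwo_le_ncard hb hζ (by omega)] with d hd
  set S := eigenvalueSums (AlgebraicClosure (ZMod 2)) (n + 1) d with hS
  have hSfin : S.Finite := finite_eigenvalueSums hb d
  set i := lightsOutCycleLength n d with hi
  have hdvd : i ∣ 2 * (2 ^ sordTwo (n + 1) - 1) := lightsOutCycleLength_dvd hn d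
  set g := Nat.gcd i (2 ^ sordTwo (n + 1) - 1) with hg
  have hgpos : 0 < g := Nat.gcd_pos_of_pos_right _ (by omega)
  -- A nonzero sum satisfies both x^i = 1 and x^(2^s - 1) = 1.
  have hsub : S ⊆ insert 0 {x | x ^ g = 1} := by
    intro x hx
    by_cases hx0 : x = 0
    · exact Or.inl hx0
    refine Or.inr (pow_gcd_eq_one.2
      ⟨(two_dvd_lightsOutCycleLength_and_pow_eq_one hn hx hx0).2, ?_⟩)
    apply mul_right_cancel₀ hx0
    rw [← pow_succ, Nat.sub_add_cancel (by omega), one_mul,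
      eigenvalueSums_pow_two_pow (sordTwo_spec hb).2 hx]
  have hroots : {x : AlgebraicClosure (ZMod 2) | x ^ g = 1}.Finite :=
    (Polynomial.finite_setOfPred_isRoot (Polynomial.X_pow_sub_C_ne_zero hgpos 1)).subset
      fun x hx => by simpa [sub_eq_zero] using hx
  have hcard : S.ncard ≤ g + 1 :=
    (Set.ncard_le_ncard hsub (hroots.insert 0)).trans
      ((Set.ncard_insert_le _ _).trans
        (Nat.succ_le_succ (ncard_setOf_pow_eq_one_le hgpos)))
  have hgeq := eq_of_dvd_two_pow_sub_one hs3 (Nat.gcd_dvd_right i _) (by omega)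
  have hSne : ∃ x ∈ S, x ≠ 0 := by
    by_contra! h
    have : S.ncard ≤ 1 := by
      rw [← Set.ncard_singleton (0 : AlgebraicClosure (ZMod 2))]
      exact Set.ncard_le_ncard fun x hx => h x hx
    omega
  obtain ⟨x, hx, hx0⟩ := hSne
  refine Nat.dvd_antisymm hdvd (Nat.Coprime.mul_dvd_of_dvd_of_dvd ?_
    (two_dvd_lightsOutCycleLength_and_pow_eq_one hn hx hx0).1 (hgeq ▸ Nat.gcd_dvd_left i _))
  rw [Nat.coprime_two_left]
  exact Nat.Even.sub_odd (by omega) ((Nat.even_pow.2 ⟨even_two, by omega⟩)) odd_one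

/-! ### Side lengths 2 and 4 -/

theorem sordTwo_three : sordTwo 3 = 1 :=
  le_antisymm (sordTwo_le one_pos (by decide)) (sordTwo_spec (by decide)).1

theorem sordTwo_five : sordTwo 5 = 2 := by
  refine le_antisymm (sordTwo_le two_pos (by decide)) ?_
  obtain ⟨h0, h⟩ := sordTwo_spec (b := 5) (by decide)
  by_contra! hlt
  rw [show sordTwo 5 = 1 by omega] at h
  exact absurd h (by decide)

theorem lightsOutCycleLength_two (d : ℕ) :
    lightsOutCycleLength 2 d = if Odd d then 2 else 1 := by
  have : CharP (AlgebraicClosure (ZMod 2)) 2 := charP_of_injective_algebraMap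
    (algebraMap (ZMod 2) (AlgebraicClosure (ZMod 2))).injective 2
  split_ifs with hd
  · obtain ⟨ζ, hζ⟩ := exists_isPrimitiveRoot_of_odd (b := 3) (by decide)
    have hζ1 : ζ ≠ 1 := hζ.ne_one (by norm_num)
    obtain ⟨k, rfl⟩ := hd
    have hx := eigenvalueSums_add_even (even_two_mul k) hζ.pow_eq_one hζ1
      (mem_eigenvalueSums_one hζ.pow_eq_one hζ1)
    rw [add_comm 1] at hx
    have h2 := lightsOutCycleLength_dvd even_two (2 * k + 1)
    rw [sordTwo_three] at h2
    exact Nat.dvd_antisymm h2 (two_dvd_lightsOutCycleLength_and_pow_eq_one even_two hx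
      (add_inv_ne_zero (by decide) hζ.pow_eq_one hζ1)).1
  -- Squaring gives `d` times the identity, so for even `d` the matrix is nilpotent.
  · have hA : lineMatrix 2 ^ 2 = 1 := by decide
    have hX : iteratedKroneckerSum (lineMatrix 2) d ^ 2 = 0 := by
      rw [iteratedKroneckerSum_sq, hA, iteratedKroneckerSum_one, ← Matrix.diagonal_natCast,
        (ZMod.natCast_eq_zero_iff d 2).2 (Nat.not_odd_iff_even.1 hd).two_dvd, Matrix.diagonal_zero]
    exact Nat.dvd_one.1 (cycleLength_dvd (k := 2) (by rw [pow_add, hX, zero_mul]))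

theorem lightsOutCycleLength_four {d : ℕ} (hd1 : 1 ≤ d) :
    lightsOutCycleLength 4 d = if Odd d then 6 else 2 := by
  have : CharP (AlgebraicClosure (ZMod 2)) 2 := charP_of_injective_algebraMap
    (algebraMap (ZMod 2) (AlgebraicClosure (ZMod 2))).injective 2
  have h4 : Even 4 := by decide
  obtain ⟨ζ, hζ⟩ := exists_isPrimitiveRoot_of_odd (b := 5) (by decide)
  have hζ1 : ζ ≠ 1 := hζ.ne_one (by norm_num)
  have hθ := mem_eigenvalueSums_one hζ.pow_eq_one hζ1
  have hθ0 : ζ + ζ⁻¹ ≠ 0 := add_inv_ne_zero (by decide) hζ.pow_eq_one hζ1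
  have hθ2 : (ζ + ζ⁻¹) ^ 2 ≠ ζ + ζ⁻¹ := by
    intro h
    exact absurd (two_pow_eq_of_add_inv_pow (m := 1) (by norm_num) hζ (by simpa using h))
      (by decide)
  split_ifs with hd
  · obtain ⟨k, rfl⟩ := hd
    have hx := eigenvalueSums_add_even (even_two_mul k) hζ.pow_eq_one hζ1 hθ
    rw [add_comm 1] at hx
    have h6 := lightsOutCycleLength_dvd h4 (2 * k + 1)
    rw [sordTwo_five] at h6
    obtain ⟨⟨q, hq⟩, h1⟩ := two_dvd_lightsOutCycleLength_and_pow_eq_one h4 hx hθ0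
    rw [hq] at h6 h1 ⊢
    rcases (Nat.dvd_prime Nat.prime_three).1 (Nat.dvd_of_mul_dvd_mul_left two_pos h6) with rfl | rfl
    -- Cycle length 2 would give θ^2 = 1 for θ = ζ + ζ⁻¹; with θ^4 = θ this makes θ = 1, against
    -- `hθ2`.
    · have h := add_inv_pow_two_pow (b := 5) (s := 2) (Or.inr (by decide)) hζ.pow_eq_one
      rw [show 2 ^ 2 = 2 * 1 * 2 by norm_num, pow_mul, h1, one_pow] at h
      exact absurd (by rw [← h, one_pow]) hθ2
    · rfl
  · obtain ⟨k, rfl⟩ := (Nat.not_odd_iff_even.1 hd).two_dvd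
    have hz1 : ζ ^ 2 ≠ 1 := hζ.pow_ne_one_of_pos_of_lt (by norm_num) (by norm_num)
    have hz : (ζ ^ 2) ^ 5 = 1 := by rw [← pow_mul, mul_comm, pow_mul, hζ.pow_eq_one, one_pow]
    -- For even `d` the nonzero eigenvalue is θ + θ^2, from the roots ζ and ζ^2, padded by k - 1
    -- cancelling pairs.
    have hx := eigenvalueSums_add_even (even_two_mul (k - 1)) hζ.pow_eq_one hζ1
      (add_mem_eigenvalueSums hθ (mem_eigenvalueSums_one hz hz1))
    rw [show 1 + 1 + 2 * (k - 1) = 2 * k by omega] at hx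
    have hx0 : ζ + ζ⁻¹ + (ζ ^ 2 + (ζ ^ 2)⁻¹) ≠ 0 := by
      intro h
      apply hθ2
      rw [CharTwo.add_sq, inv_pow]
      exact (CharTwo.add_eq_zero.1 h).symm
    have hA : lineMatrix 4 ^ 2 ^ 2 = lineMatrix 4 ^ 2 + 1 := by decide
    have hX : iteratedKroneckerSum (lineMatrix 4) (2 * k) ^ 2 =
        iteratedKroneckerSum (lineMatrix 4) (2 * k) ^ (2 + 2) := by
      rw [show 2 + 2 = 2 ^ 2 by norm_num, iteratedKroneckerSum_pow_two_pow, hA,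
        iteratedKroneckerSum_add, iteratedKroneckerSum_one, ← Matrix.diagonal_natCast,
        (ZMod.natCast_eq_zero_iff (2 * k) 2).2 (dvd_mul_right 2 k), Matrix.diagonal_zero, add_zero,
        iteratedKroneckerSum_sq]
    exact Nat.dvd_antisymm (cycleLength_dvd hX)
      (two_dvd_lightsOutCycleLength_and_pow_eq_one h4 hx hx0).1

theorem mainTheorem2 :
    -- the transition matrix is the `d`-fold Kronecker sum of `A_n`
    (∀ n d : ℕ, 1 ≤ n → 1 ≤ d → ∀ v : (Fin d → Fin n) → ZMod 2,
      lightsOutStep v = (iteratedKroneckerSum (lineMatrix n) d).mulVec v) ∧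
    -- the cycle length is bounded independently of `d`
    (∀ n : ℕ, 1 ≤ n → ∃ C : ℕ, ∀ d : ℕ, 1 ≤ d →
      0 < lightsOutCycleLength n d ∧ lightsOutCycleLength n d ≤ C) ∧
    -- for even `n` it divides the maximum possible value
    (∀ n : ℕ, 1 ≤ n → Even n → ∀ d : ℕ, 1 ≤ d →
      lightsOutCycleLength n d ∣ 2 * (2 ^ sordTwo (n + 1) - 1)) ∧
    -- for even `n ≥ 6` it is equal to this value in all sufficiently large dimensions
    (∀ n : ℕ, 6 ≤ n → Even n → ∃ D : ℕ, ∀ d : ℕ, D ≤ d →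
      lightsOutCycleLength n d = 2 * (2 ^ sordTwo (n + 1) - 1)) ∧
    -- for `n = 2` and `n = 4` it alternates with the parity of `d`
    (∀ d : ℕ, 1 ≤ d → lightsOutCycleLength 2 d = if Odd d then 2 else 1) ∧
    (∀ d : ℕ, 1 ≤ d → lightsOutCycleLength 4 d = if Odd d then 6 else 2) := by
  refine ⟨fun n d _ _ v => lightsOutStep_eq_mulVec v, fun n _ => ?_,
    fun n _ hn d _ => lightsOutCycleLength_dvd hn d,
    fun n h6 hn => Filter.eventually_atTop.1 (lightsOutCycleLength_eventually_eq h6 hn),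
    fun d _ => lightsOutCycleLength_two d, fun d hd => lightsOutCycleLength_four hd⟩
  obtain ⟨C, hC⟩ := exists_lightsOutCycleLength_le n
  exact ⟨C, fun d _ => hC d⟩
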